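/- Definitions. An infinite plane framework $(G,p)$ is a graph $G$ with countably infinite vertex set $\{v_1,v_2,\dots\}$ together with a sequence $p=(p_1,p_2,\dots)$ in $\mathbb{R}^2$ (the framework vector) such that $p_i\neq p_j$ whenever $(v_i,v_j)$ is an edge; the length of the edge $(v_i,v_j)$ is $|p_i-p_j|$. It is locally finite if every vertex has finite degree, and pointed if the sequence $p$ converges and the sequence of edge lengths (in any enumeration of the edges) tends to $0$. A motion of $(G,p)$ is a family $p(t)=(p_1(t),p_2(t),\dots)$, $t\in[0,1]$, with $p(0)=p$, every $p_i(t)$ continuous in $t$, and $|p_i(t)-p_j(t)|=|p_i-p_j|$ for every edge $(v_i,v_j)$ and all $t$. A proper flex is a nonconstant motion for which some edge $(v_a,v_b)$ (with $p_a\ne p_b$) has both end points fixed for all $t$. An infinite plane linkage is an infinite plane framework $(G,p)$ with $G$ connected, in which $v_1$ has degree two with edges $(v_1,v_2)$, $(v_1,v_3)$, together with a proper flex $p(t)$ such that $p_1(t)=(0,0)$ for all $t$ and (i) the function $g(t)=\langle p_2(t)-p_1(t),\,p_3(t)-p_1(t)\rangle$ is strictly increasing on $[0,1]$, and (ii) $p(t)$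 is the only motion $q(t)$ of $(G,p)$ with $q_i(t)=p_i(t)$ for all $t$ and $i=1,2,3$. Theorem. Let $f:[0,2\pi]\to\mathbb{R}$ be a continuous function whose Fourier series is absolutely summable, i.e. $\sum_{n\in\mathbb{Z}}|\hat f(n)|<\infty$, where $\hat f(n)=\frac1{2\pi}\int_0^{2\pi}f(t)e^{-int}\,dt$. Then there is a pointed, locally finite infinite plane linkage $(G,p)$, with flex $p(t)$, that realises the graph of $f$ exactly: for every $t\in[0,1]$ the limit $p^*(t)=\lim_{n\to\infty}p_n(t)$ exists, $p^*$ is continuous with strictly increasing first coordinate, and $$\{p^*(t): t\in[0,1]\}=\{(s,f(s)): s\in[0,2\pi]\}.$$ -/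

import Mathlib

open Filter Topology

/-- The Euclidean plane. -/
abbrev Plane : Type := EuclideanSpace ℝ (Fin 2)

/-- A countably infinite bar-joint framework in the plane. The vertices are enumerated by `ℕ`,
`pos` is the framework vector, and every edge is a genuine (non-degenerate) segment. Different
vertices may be placed at the same point if they are not adjacent. The first three vertices
`v₁, v₂, v₃` of the enumeration are the numbers `0, 1, 2`. -/
structure InfFramework where
  /-- the abstract graph -/
  graph : SimpleGraph ℕ
  /-- the framework vector -/
  pos : ℕ → Plane
  /-- edges have positive length -/
  pos_ne : ∀ i j, graph.Adj i j → pos i ≠ pos j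

namespace InfFramework

/-- The length of the framework edge of an (unordered) pair of vertices. -/
noncomputable def edgeLength (F : InfFramework) (e : Sym2 ℕ) : ℝ :=
  Sym2.lift ⟨fun i j => dist (F.pos i) (F.pos j), fun _ _ => dist_comm _ _⟩ e

/-- Every vertex has finite degree. -/
def LocallyFinite (F : InfFramework) : Prop :=
  ∀ v, (F.graph.neighborSet v).Finite

/-- The framework vector converges and the edge lengths tend to zero (along any enumeration of
the edges, that is, along the cofinite filter on the set of edges). -/
def Pointed (F : InfFramework) : Prop :=
  (∃ x : Plane, Tendsto F.pos atTop (𝓝 x)) ∧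
    Tendsto (fun e : F.graph.edgeSet => F.edgeLength e) cofinite (𝓝 0)

/-- `P t i` is the position of the vertex `i` at time `t ∈ [0,1]`: the motion starts at the
framework, moves every vertex continuously and conserves every edge length. -/
structure IsMotion (F : InfFramework) (P : unitInterval → ℕ → Plane) : Prop where
  start : P 0 = F.pos
  continuous : ∀ i, Continuous fun t => P t i
  isometric : ∀ i j, F.graph.Adj i j → ∀ t, dist (P t i) (P t j) = dist (P 0 i) (P 0 j)

/-- A proper continuous flex: a nonconstant motion that keeps some base edge fixed. -/
structure IsProperFlex (F : InfFramework) (P : unitInterval → ℕ → Plane) : Prop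
    extends F.IsMotion P where
  base : ∃ a b, F.graph.Adj a b ∧ F.pos a ≠ F.pos b ∧ ∀ t, P t a = P 0 a ∧ P t b = P 0 b
  nonconstant : ∃ t, P t ≠ P 0

/-- The framework `F` together with the flex `P` is an infinite plane linkage, normalised so that
the first vertex stays at the origin. In `unique`, the competitor `Q` is any motion; it need not
be assumed to have a base edge. -/
structure IsLinkage (F : InfFramework) (P : unitInterval → ℕ → Plane) : Prop where
  connected : F.graph.Connected
  degree_two : F.graph.neighborSet 0 = {1, 2}
  flex : F.IsProperFlex P
  normalised : ∀ t, P t 0 = 0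
  strictMono : StrictMono fun t => inner ℝ (P t 1 - P t 0) (P t 2 - P t 0)
  unique : ∀ Q : unitInterval → ℕ → Plane, F.IsMotion Q →
    (∀ t, Q t 0 = P t 0 ∧ Q t 1 = P t 1 ∧ Q t 2 = P t 2) → Q = P

/-- Under the flex `P` the vertices converge, at each time, to a point that traces out the plane
set `C`, exactly once and from left to right. -/
def LimitPointTraces (P : unitInterval → ℕ → Plane) (C : Set Plane) : Prop :=
  ∃ γ : unitInterval → Plane, Continuous γ ∧
    (∀ t, Tendsto (fun n => P t n) atTop (𝓝 (γ t))) ∧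
    StrictMono (fun t => γ t 0) ∧ Set.range γ = C

end InfFramework

/-- The graph of `f` over the set `s`, as a subset of the plane. -/
def planeGraph (f : ℝ → ℝ) (s : Set ℝ) : Set Plane :=
  {x | x 0 ∈ s ∧ x 1 = f (x 0)}

/-!
The plane is identified with `ℂ`. The linkage is driven by a bar from the vertex `0` in the
direction `ζ = exp (i θ)`, where the angle `θ` grows from `-π / 2` to `-π / 4` as `t` runs through
`[0, 1]`. With `s = 2 * π * t = 8 * (θ + π / 2)` the point `s + i f s` is an absolutely summable
series `∑ c n * ζ ^ n` over `n : ℤ`: the frequency `n` of `f` becomes `8 * n`, and `s` itself has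
a summable series on the arc, because it is a difference of two values of the second Bernoulli
polynomial (`exists_hasSum_zpow`). It remains to build a linkage that sums such a series.

Every vertex from the fourth on is attached by two bars to two earlier vertices, and the triangle
they form is either collinear at all times or at no time. Then the distances determine the new
vertex up to reflection, and continuity rules the reflection out (`Attached.eq_of_dist_eq`), so by
induction the motion is determined by that of the first three vertices. As the two earlier
vertices precede by a bounded number of places, the graph is locally finite, and convergence of
the positions makes the bars short (`AttachedSystem.pointed`).

The series is summed along a walk with steps `±1` through all integers (`walk`). A block of ten
vertices belongs to each step. It starts from a joint with two short bars in the directions `ζ ^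
k` and `ζ ^ l`, where `k`, `l` are consecutive places of the walk. A pair of similar
contraparallelograms reflects the first bar in the second and so produces the direction `ζ ^ (2 *
l - k)` (`attached_contraparallelogram`, `attached_mirror`); hence the next direction of the walk
is available, whether the walk goes on or turns back. Then the joint is displaced by `c * ζ ^ l`,
along with the two bars needed next. The angle between these bars is always `±θ`, so no
parallelogram or contraparallelogram ever becomes flat: this is why the walk changes the frequency
by one at a time. The displacement is split into two nonzero ones within the angle `π / 4` of the
line of `ζ ^ l`, which takes care of vanishing and complex coefficients. The blocks shrink, so
that all vertices converge to the sum of the series (`tendsto_position`).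
-/

/-! ### Vertices attached to two earlier vertices -/

/-- The signed area (twice) of the triangle `A`, `B`, `X`; it vanishes exactly when the three
points are collinear. -/
noncomputable def signedArea (A B X : ℂ) : ℝ :=
  ((X - A) * (starRingEnd ℂ) (B - A)).im

/-- The moving point `X` is attached to the moving points `A` and `B` by two bars: the distances
from `X` to `A` and to `B` are positive constants, `A` and `B` never meet, and the triangle
`A`, `B`, `X` either is always degenerate or never degenerates. -/
structure Attached (A B X : unitInterval → ℂ) : Prop where
  dist_left : ∃ d : ℝ, 0 < d ∧ ∀ t, dist (X t) (A t) = d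
  dist_right : ∃ d : ℝ, 0 < d ∧ ∀ t, dist (X t) (B t) = d
  ne : ∀ t, A t ≠ B t
  area : (∀ t, signedArea (A t) (B t) (X t) = 0) ∨ ∀ t, signedArea (A t) (B t) (X t) ≠ 0

theorem re_mul_conj_eq_of_norm_eq {p r w : ℂ} (h : ‖p‖ = ‖r‖) (h' : ‖p - w‖ = ‖r - w‖) :
    (p * (starRingEnd ℂ) w).re = (r * (starRingEnd ℂ) w).re := by
  have e : p.re * p.re + p.im * p.im = r.re * r.re + r.im * r.im := by
    rw [← Complex.normSq_apply, ← Complex.normSq_apply, ← Complex.sq_norm, ← Complex.sq_norm, h]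
  have e' : (p.re - w.re) * (p.re - w.re) + (p.im - w.im) * (p.im - w.im)
      = (r.re - w.re) * (r.re - w.re) + (r.im - w.im) * (r.im - w.im) := by
    simp only [← Complex.sub_re, ← Complex.sub_im]
    rw [← Complex.normSq_apply, ← Complex.normSq_apply, ← Complex.sq_norm, ← Complex.sq_norm, h']
  simp only [Complex.mul_re, Complex.conj_re, Complex.conj_im]
  linarith

theorem im_mul_conj_sq_eq_of_norm_eq {p r w : ℂ} (h : ‖p‖ = ‖r‖) (h' : ‖p - w‖ = ‖r - w‖) :
    (p * (starRingEnd ℂ) w).im ^ 2 = (r * (starRingEnd ℂ) w).im ^ 2 := by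
  have hre := re_mul_conj_eq_of_norm_eq h h'
  have e : ‖p * (starRingEnd ℂ) w‖ ^ 2 = ‖r * (starRingEnd ℂ) w‖ ^ 2 := by
    rw [norm_mul, norm_mul, h]
  rw [Complex.sq_norm, Complex.sq_norm, Complex.normSq_apply, Complex.normSq_apply, hre] at e
  nlinarith

/-- A point attached to two others moves in only one way. The distances determine the signed area
up to sign; in the nondegenerate case the sign cannot change, by continuity. -/
theorem Attached.eq_of_dist_eq {A B X Y : unitInterval → ℂ} (h : Attached A B X)
    (hA : Continuous A) (hB : Continuous B) (hX : Continuous X) (hY : Continuous Y)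
    (h0 : Y 0 = X 0) (hYA : ∀ t, dist (Y t) (A t) = dist (X t) (A t))
    (hYB : ∀ t, dist (Y t) (B t) = dist (X t) (B t)) : Y = X := by
  have n1 : ∀ t, ‖Y t - A t‖ = ‖X t - A t‖ := fun t => by
    simpa [dist_eq_norm] using hYA t
  have n2 : ∀ t, ‖(Y t - A t) - (B t - A t)‖ = ‖(X t - A t) - (B t - A t)‖ := fun t => by
    simpa [dist_eq_norm] using hYB t
  have key : ∀ t, signedArea (A t) (B t) (Y t) = signedArea (A t) (B t) (X t) → Y t = X t := by
    intro t ht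
    have hw : (starRingEnd ℂ) (B t - A t) ≠ 0 := by
      rw [Ne, map_eq_zero, sub_eq_zero]
      exact (h.ne t).symm
    have := mul_right_cancel₀ hw
      (Complex.ext (re_mul_conj_eq_of_norm_eq (n1 t) (n2 t)) ht)
    simpa using this
  have hsq : ∀ t, signedArea (A t) (B t) (Y t) ^ 2 = signedArea (A t) (B t) (X t) ^ 2 :=
    fun t => im_mul_conj_sq_eq_of_norm_eq (n1 t) (n2 t)
  funext t
  refine key t ?_
  rcases h.area with h | h
  · have := hsq t
    rw [h t] at this ⊢
    simpa using this
  · have c : ∀ Z : unitInterval → ℂ, Continuous Z →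
        Continuous fun t => signedArea (A t) (B t) (Z t) := fun Z hZ => by
      unfold signedArea
      exact Complex.continuous_im.comp ((hZ.sub hA).mul (Complex.continuous_conj.comp (hB.sub hA)))
    exact isPreconnected_univ.eq_of_sq_eq (c Y hY).continuousOn (c X hX).continuousOn
      (fun t _ => hsq t) (fun {t} _ => h t) (Set.mem_univ 0) (by simp only [h0]) (Set.mem_univ t)

/-! ### The framework of a system of attached vertices -/

/-- The isometric identification of the complex plane with the Euclidean plane. -/
noncomputable def toPlane : ℂ ≃ₗᵢ[ℝ] Plane := Complex.orthonormalBasisOneI.repr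

theorem toPlane_apply_zero (z : ℂ) : toPlane z 0 = z.re := by
  simp [toPlane, Complex.orthonormalBasisOneI_repr_apply]

theorem toPlane_apply_one (z : ℂ) : toPlane z 1 = z.im := by
  simp [toPlane, Complex.orthonormalBasisOneI_repr_apply]

/-- A system of moving points `x · n` in the complex plane, in which the points `1` and `2` are
joined to the point `0` and every later point is attached to two earlier points `a n` and `b n`
other than `0`. The index drop `n - a n` is bounded, so that no point carries infinitely many
bars. -/
structure AttachedSystem (x : unitInterval → ℕ → ℂ) (a b : ℕ → ℕ) : Prop where
  continuous : ∀ n, Continuous fun t => x t n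
  attached : ∀ n, 3 ≤ n → Attached (fun t => x t (a n)) (fun t => x t (b n)) (fun t => x t n)
  lt_left : ∀ n, 1 ≤ n → a n < n
  lt_right : ∀ n, 1 ≤ n → b n < n
  near_left : ∀ n, n ≤ a n + 20
  near_right : ∀ n, n ≤ b n + 20
  base_left : a 1 = 0 ∧ a 2 = 0
  base_right : b 1 = 0 ∧ b 2 = 0
  ne_left : ∀ n, 3 ≤ n → a n ≠ 0
  ne_right : ∀ n, 3 ≤ n → b n ≠ 0
  zero : ∀ t, x t 0 = 0
  one : ∀ t, x t 1 = 1
  two : ∀ t, ‖x t 2‖ = 1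
  strictMono : StrictMono fun t => (x t 2).re

namespace AttachedSystem

variable {x : unitInterval → ℕ → ℂ} {a b : ℕ → ℕ}

/-- A bar of the system: a pair of a positive number and one of its two predecessors. -/
def Bar (a b : ℕ → ℕ) (n p : ℕ) : Prop := 1 ≤ n ∧ (p = a n ∨ p = b n)

theorem lt_of_bar (h : AttachedSystem x a b) {n p : ℕ} (hb : Bar a b n p) : p < n := by
  rcases hb with ⟨h1, rfl | rfl⟩
  exacts [h.lt_left n h1, h.lt_right n h1]

theorem le_of_bar (h : AttachedSystem x a b) {n p : ℕ} (hb : Bar a b n p) : n ≤ p + 20 := by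
  rcases hb with ⟨_, rfl | rfl⟩
  exacts [h.near_left n, h.near_right n]

theorem exists_dist_of_bar (h : AttachedSystem x a b) {n p : ℕ} (hb : Bar a b n p) :
    ∃ d : ℝ, 0 < d ∧ ∀ t, dist (x t n) (x t p) = d := by
  obtain ⟨h1, hp⟩ := hb
  by_cases h3 : 3 ≤ n
  · rcases hp with rfl | rfl
    exacts [(h.attached n h3).dist_left, (h.attached n h3).dist_right]
  · have hn : n = 1 ∨ n = 2 := by omega
    have hp0 : p = 0 := by
      rcases hn with rfl | rfl <;> rcases hp with rfl | rfl
      exacts [h.base_left.1, h.base_right.1, h.base_left.2, h.base_right.2]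
    subst hp0
    refine ⟨1, one_pos, fun t => ?_⟩
    rcases hn with rfl | rfl
    · simp [h.zero, h.one]
    · simp [h.zero, h.two]

/-- The graph whose edges are the bars of the system. -/
def barGraph (h : AttachedSystem x a b) : SimpleGraph ℕ where
  Adj i j := Bar a b i j ∨ Bar a b j i
  symm := ⟨fun _ _ => Or.symm⟩
  loopless := ⟨fun i hi => by
    rcases hi with hi | hi <;> exact lt_irrefl _ (h.lt_of_bar hi)⟩

theorem exists_dist_of_adj (h : AttachedSystem x a b) {i j : ℕ} (hij : h.barGraph.Adj i j) :
    ∃ d : ℝ, 0 < d ∧ ∀ t, dist (x t i) (x t j) = d := by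
  rcases hij with hij | hij
  · exact h.exists_dist_of_bar hij
  · obtain ⟨d, hd, e⟩ := h.exists_dist_of_bar hij
    exact ⟨d, hd, fun t => by rw [dist_comm, e]⟩

/-- The framework of the system in its initial position. -/
noncomputable def framework (h : AttachedSystem x a b) : InfFramework where
  graph := h.barGraph
  pos n := toPlane (x 0 n)
  pos_ne i j hij := by
    obtain ⟨d, hd, e⟩ := h.exists_dist_of_adj hij
    intro he
    rw [← e 0, toPlane.injective he, dist_self] at hd
    exact lt_irrefl _ hd

/-- The motion of the framework given by the moving points of the system. -/
noncomputable def motion (x : unitInterval → ℕ → ℂ) (t : unitInterval) (n : ℕ) : Plane :=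
  toPlane (x t n)

theorem isMotion (h : AttachedSystem x a b) : h.framework.IsMotion (motion x) where
  start := rfl
  continuous i := toPlane.continuous.comp (h.continuous i)
  isometric i j hij t := by
    obtain ⟨d, _, e⟩ := h.exists_dist_of_adj hij
    simp only [motion, toPlane.dist_map, e]

theorem inner_motion (h : AttachedSystem x a b) (t : unitInterval) :
    inner ℝ (motion x t 1 - motion x t 0) (motion x t 2 - motion x t 0) = (x t 2).re := by
  simp [motion, h.zero, h.one, toPlane.inner_map_map, Complex.inner]

theorem isProperFlex (h : AttachedSystem x a b) : h.framework.IsProperFlex (motion x) where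
  toIsMotion := h.isMotion
  base := by
    have hadj : h.framework.graph.Adj 0 1 := Or.inr ⟨le_rfl, Or.inl h.base_left.1.symm⟩
    exact ⟨0, 1, hadj, h.framework.pos_ne _ _ hadj, fun t => by simp [motion, h.zero, h.one]⟩
  nonconstant := by
    refine ⟨1, fun he => ?_⟩
    have h2 : x 1 2 = x 0 2 := toPlane.injective (congrFun he 2)
    have h01 := h.strictMono (show (0 : unitInterval) < 1 from zero_lt_one)
    simp [h2] at h01

theorem connected (h : AttachedSystem x a b) : h.framework.graph.Connected := by
  have key : ∀ n, h.framework.graph.Reachable n 0 := by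
    intro n
    induction n using Nat.strong_induction_on with
    | _ n ih =>
      rcases Nat.eq_zero_or_pos n with rfl | hn
      · exact SimpleGraph.Reachable.refl _
      · have hadj : h.framework.graph.Adj n (a n) := Or.inl ⟨hn, Or.inl rfl⟩
        exact hadj.reachable.trans (ih _ (h.lt_left n hn))
  exact ⟨fun u v => (key u).trans (key v).symm⟩

theorem neighborSet_zero (h : AttachedSystem x a b) :
    h.framework.graph.neighborSet 0 = {1, 2} := by
  ext n
  simp only [SimpleGraph.mem_neighborSet, Set.mem_insert_iff, Set.mem_singleton_iff]
  constructor
  · rintro (⟨h0, _⟩ | ⟨h1, hn⟩)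
    · omega
    · by_contra hne
      have h3 : 3 ≤ n := by omega
      rcases hn with hn | hn
      exacts [h.ne_left n h3 hn.symm, h.ne_right n h3 hn.symm]
  · rintro (rfl | rfl)
    · exact Or.inr ⟨by norm_num, Or.inl h.base_left.1.symm⟩
    · exact Or.inr ⟨by norm_num, Or.inl h.base_left.2.symm⟩

theorem eq_motion (h : AttachedSystem x a b) (Q : unitInterval → ℕ → Plane)
    (hQ : h.framework.IsMotion Q)
    (hb : ∀ t, Q t 0 = motion x t 0 ∧ Q t 1 = motion x t 1 ∧ Q t 2 = motion x t 2) :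
    Q = motion x := by
  have hdist : ∀ i j, h.framework.graph.Adj i j → ∀ t,
      dist (toPlane.symm (Q t i)) (toPlane.symm (Q t j)) = dist (x t i) (x t j) := by
    intro i j hij t
    obtain ⟨d, _, e⟩ := h.exists_dist_of_adj hij
    rw [toPlane.symm.dist_map, hQ.isometric i j hij t, hQ.start]
    simp only [framework, toPlane.dist_map, e]
  have key : ∀ n, (fun t => toPlane.symm (Q t n)) = fun t => x t n := by
    intro n
    induction n using Nat.strong_induction_on with
    | _ n ih =>
      by_cases h3 : 3 ≤ n
      · have h1 : 1 ≤ n := by omega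
        have ea := fun t => congrFun (ih _ (h.lt_left n h1)) t
        have eb := fun t => congrFun (ih _ (h.lt_right n h1)) t
        refine (h.attached n h3).eq_of_dist_eq (h.continuous _) (h.continuous _) (h.continuous _)
          (toPlane.symm.continuous.comp (hQ.continuous n)) ?_ (fun t => ?_) (fun t => ?_)
        · simp [hQ.start, framework]
        · rw [← hdist n (a n) (Or.inl ⟨h1, Or.inl rfl⟩) t]
          exact congrArg _ (ea t).symm
        · rw [← hdist n (b n) (Or.inl ⟨h1, Or.inr rfl⟩) t]
          exact congrArg _ (eb t).symm
      · funext t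
        obtain ⟨h0, h1, h2⟩ := hb t
        have : n = 0 ∨ n = 1 ∨ n = 2 := by omega
        rcases this with rfl | rfl | rfl <;> simp_all [motion]
  funext t n
  rw [motion, ← congrFun (key n) t, toPlane.apply_symm_apply]

theorem isLinkage (h : AttachedSystem x a b) : h.framework.IsLinkage (motion x) where
  connected := h.connected
  degree_two := h.neighborSet_zero
  flex := h.isProperFlex
  normalised t := by simp [motion, h.zero]
  strictMono := by
    simp only [h.inner_motion]
    exact h.strictMono
  unique := h.eq_motion

theorem neighborSet_subset_Iic (h : AttachedSystem x a b) (v : ℕ) :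
    h.framework.graph.neighborSet v ⊆ Set.Iic (v + 20) := by
  rintro w (hw | hw)
  · exact (h.lt_of_bar hw).le.trans (Nat.le_add_right _ _)
  · exact h.le_of_bar hw

theorem locallyFinite (h : AttachedSystem x a b) : h.framework.LocallyFinite := fun v =>
  (Set.finite_Iic (v + 20)).subset (h.neighborSet_subset_Iic v)

/-- If the initial positions converge then so do the lengths of the bars, since all but finitely
many bars have both ends close to the limit. -/
theorem pointed (h : AttachedSystem x a b) {z : ℂ} (hz : Tendsto (x 0) atTop (𝓝 z)) :
    h.framework.Pointed := by
  refine ⟨⟨toPlane z, (toPlane.continuous.tendsto z).comp hz⟩, ?_⟩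
  rw [Metric.tendsto_nhds]
  intro r hr
  obtain ⟨N, hN⟩ := Metric.tendsto_atTop.1 hz (r / 2) (half_pos hr)
  have hfin : (Set.Iic (N + 20) ×ˢ Set.Iic (N + 20) : Set (ℕ × ℕ)).Finite :=
    (Set.finite_Iic _).prod (Set.finite_Iic _)
  have hfin2 : {e : h.framework.graph.edgeSet | (e : Sym2 ℕ) ∈
      (fun p : ℕ × ℕ => s(p.1, p.2)) '' (Set.Iic (N + 20) ×ˢ Set.Iic (N + 20))}.Finite :=
    (hfin.image _).preimage Subtype.val_injective.injOn
  refine mem_of_superset hfin2.compl_mem_cofinite ?_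
  rintro ⟨e, he⟩ hmem
  induction e using Sym2.ind with
  | _ i j =>
    have hadj : h.framework.graph.Adj i j := he
    have hi := h.neighborSet_subset_Iic i hadj
    have hj := h.neighborSet_subset_Iic j hadj.symm
    simp only [Set.mem_Iic] at hi hj
    have hor : N ≤ i ∧ N ≤ j := by
      by_contra hlt
      refine hmem ⟨(i, j), ⟨?_, ?_⟩, rfl⟩ <;> simp only [Set.mem_Iic] <;> omega
    have h1 := hN i hor.1
    have h2 := hN j hor.2
    have h3 := dist_triangle_right (x 0 i) (x 0 j) z
    have h4 : h.framework.edgeLength s(i, j) = dist (x 0 i) (x 0 j) := toPlane.dist_map _ _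
    simp only [Set.mem_ofPred_eq, h4, Real.dist_eq, sub_zero, abs_of_nonneg dist_nonneg]
    linarith

end AttachedSystem

/-! ### Absolutely summable Fourier series on an arc -/

open MeasureTheory AddCircle in
/-- A continuous function on a closed interval whose Fourier coefficients are absolutely summable
is the sum of its Fourier series, at the end points too. The function need not be assumed periodic:
it agrees almost everywhere, and hence by continuity everywhere, with the continuous periodic sum
of the series. -/
theorem hasSum_fourierCoeff_liftIoc {T : ℝ} [hT : Fact (0 < T)] {a : ℝ} {f : ℝ → ℂ}
    (hf : ContinuousOn f (Set.Icc a (a + T)))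
    (hs : Summable fun n => ‖fourierCoeff (liftIoc T a f) n‖) {x : ℝ}
    (hx : x ∈ Set.Icc a (a + T)) :
    HasSum (fun n => fourierCoeff (liftIoc T a f) n * fourier n (x : AddCircle T)) (f x) := by
  have hne : a ≠ a + T := by have := hT.out; linarith
  have hmem : MemLp f 2 (volume.restrict (Set.Ioc a (a + T))) := by
    obtain ⟨C, hC⟩ := isCompact_Icc.exists_bound_of_continuousOn hf
    refine MemLp.of_bound ?_ C ?_
    · exact (hf.mono Set.Ioc_subset_Icc_self).aestronglyMeasurable measurableSet_Ioc
    · exact (ae_restrict_iff' measurableSet_Ioc).2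
        (ae_of_all _ fun y hy => hC y (Set.Ioc_subset_Icc_self hy))
  have hL := hmem.memLp_liftIoc.haarAddCircle
  have hsumC : Summable fun n =>
      fourierCoeff (liftIoc T a f) n • (fourier n : C(AddCircle T, ℂ)) := by
    refine Summable.of_norm ?_
    simpa only [norm_smul, fourier_norm, mul_one] using hs
  obtain ⟨g, hg⟩ := hsumC
  have hgL : ContinuousMap.toLp (E := ℂ) 2 haarAddCircle ℂ g = hL.toLp := by
    have h1 := (ContinuousMap.toLp (E := ℂ) 2 (haarAddCircle (T := T)) ℂ).hasSum hg
    have h2 := hasSum_fourier_series_L2 hL.toLp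
    refine h1.unique ?_
    convert! h2 using 2 with n
    rw [map_smul, fourierCoeff_congr_ae hL.coeFn_toLp]
  have hae : (liftIoc T a f) =ᵐ[volume] g := by
    rw [volume_eq_smul_haarAddCircle]
    refine Measure.ae_smul_measure ?_ _
    refine hL.coeFn_toLp.symm.trans ?_
    rw [← hgL]
    exact ContinuousMap.coeFn_toLp _ g
  have hae2 : f =ᵐ[volume.restrict (Set.Icc a (a + T))] fun y => g (y : AddCircle T) := by
    rw [← restrict_Ioc_eq_restrict_Icc]
    have h3 := (AddCircle.measurePreserving_mk T a).quasiMeasurePreserving.ae hae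
    filter_upwards [h3, ae_restrict_mem measurableSet_Ioc] with y hy hy'
    rw [← hy]
    exact (liftIoc_coe_apply hy').symm
  have heq := Measure.eqOn_Icc_of_ae_eq volume hne hae2 hf
    (g.continuous.comp (AddCircle.continuous_mk' T)).continuousOn hx
  rw [heq]
  exact (ContinuousMap.evalCLM ℂ (x : AddCircle T)).hasSum hg

theorem hasSum_fourierCoeffOn_two_pi {f : ℝ → ℂ} (hf : ContinuousOn f (Set.Icc 0 (2 * Real.pi)))
    (hs : Summable fun n => ‖fourierCoeffOn Real.two_pi_pos f n‖) {x : ℝ}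
    (hx : x ∈ Set.Icc 0 (2 * Real.pi)) :
    HasSum (fun n : ℤ => fourierCoeffOn Real.two_pi_pos f n * Complex.exp (n * x * Complex.I))
      (f x) := by
  have : Fact (0 < 2 * Real.pi - 0) := ⟨by simpa using Real.two_pi_pos⟩
  have e : (0 : ℝ) + (2 * Real.pi - 0) = 2 * Real.pi := by ring
  have h := hasSum_fourierCoeff_liftIoc (T := 2 * Real.pi - 0) (a := 0) (f := f) (by rwa [e]) hs
    (by rwa [e] : x ∈ Set.Icc 0 (0 + (2 * Real.pi - 0)))
  convert! h using 2 with n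
  rw [fourierCoeffOn, fourier_coe_apply]
  congr 2
  have : (Real.pi : ℂ) ≠ 0 := by exact_mod_cast Real.pi_ne_zero
  push_cast
  field_simp
  ring

/-- On the interval `[0, π]` the identity is an absolutely summable sum of exponentials of period
`2 * π`: the second Bernoulli polynomial satisfies `B₂(x + 1/2) - B₂(x) = x - 1/4`, and its Fourier
coefficients decay quadratically. -/
theorem exists_hasSum_exp_eq_self : ∃ d : ℤ → ℂ, (Summable fun n => ‖d n‖) ∧
    ∀ x ∈ Set.Icc (0 : ℝ) Real.pi,
      HasSum (fun n : ℤ => d n * Complex.exp (n * x * Complex.I)) x := by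
  have hpi : (Real.pi : ℂ) ≠ 0 := by exact_mod_cast Real.pi_ne_zero
  have hpos := Real.pi_pos
  have hsq : Summable fun n : ℤ => ‖(1 : ℂ) / (n : ℂ) ^ 2‖ := by
    have := Real.summable_one_div_int_pow.2 one_lt_two
    simpa using this
  have hexp : ∀ (n : ℤ) (y : ℝ), ‖Complex.exp (n * y * Complex.I)‖ = 1 := fun n y => by
    rw [← Complex.norm_exp_ofReal_mul_I (n * y)]
    push_cast
    rfl
  refine ⟨fun n => (Real.pi / 2 : ℂ) * (if n = 0 then 1 else 0) + (1 / Real.pi : ℂ) *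
    (1 / (n : ℂ) ^ 2 * Complex.exp (n * Real.pi * Complex.I) - 1 / (n : ℂ) ^ 2), ?_, ?_⟩
  · refine Summable.norm (Summable.add ?_ (Summable.mul_left _ (Summable.sub ?_ hsq.of_norm)))
    · refine summable_of_ne_finset_zero (s := {0}) fun n hn => ?_
      rw [if_neg (by simpa using hn), mul_zero]
    · refine Summable.of_norm ?_
      simpa only [norm_mul, hexp, mul_one] using hsq
  · intro x hx
    have h0 := hasSum_one_div_pow_mul_fourier_mul_bernoulliFun le_rfl
      (x := x / (2 * Real.pi)) ⟨div_nonneg hx.1 (by positivity), by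
        rw [div_le_one (by positivity)]; linarith [hx.2]⟩
    have h1 := hasSum_one_div_pow_mul_fourier_mul_bernoulliFun le_rfl
      (x := x / (2 * Real.pi) + 1 / 2) ⟨add_nonneg (div_nonneg hx.1 (by positivity))
        (by norm_num), by
        have : x / (2 * Real.pi) ≤ 1 / 2 := by
          rw [div_le_iff₀ (by positivity)]; linarith [hx.2]
        linarith⟩
    have hc : HasSum (fun n : ℤ => (if n = 0 then (1 : ℂ) else 0) *
        Complex.exp (n * x * Complex.I)) 1 := by
      convert hasSum_ite_eq (0 : ℤ) (1 : ℂ) using 2 with n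
      split_ifs with h
      · simp [h]
      · simp
    convert! (hc.mul_left (Real.pi / 2 : ℂ)).add ((h1.sub h0).mul_left (1 / Real.pi : ℂ)) using 1
    · funext n
      have e0 : fourier n ((x / (2 * Real.pi) : ℝ) : AddCircle (1 : ℝ)) =
          Complex.exp (n * x * Complex.I) := by
        rw [fourier_coe_apply]
        congr 1
        push_cast
        field_simp
      have e1 : fourier n ((x / (2 * Real.pi) + 1 / 2 : ℝ) : AddCircle (1 : ℝ)) =
          Complex.exp (n * Real.pi * Complex.I) * Complex.exp (n * x * Complex.I) := by
        rw [fourier_coe_apply, ← Complex.exp_add]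
        congr 1
        push_cast
        field_simp
        ring
      rw [e0, e1]
      ring
    · rw [bernoulliFun_two, bernoulliFun_two]
      push_cast
      rw [mul_pow, Complex.I_sq]
      simp only [Nat.factorial]
      push_cast
      field_simp
      ring

theorem exp_sub_half_pi_zpow (y : ℝ) (n : ℤ) :
    Complex.exp (((y - Real.pi / 2 : ℝ) : ℂ) * Complex.I) ^ n =
      Complex.exp (-(n * (Real.pi / 2) * Complex.I)) * Complex.exp (n * y * Complex.I) := by
  rw [← Complex.exp_int_mul, ← Complex.exp_add]
  congr 1
  push_cast
  ring

/-- The graph of `f`, viewed as a curve in the complex plane and parametrised by an angle that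
runs through an arc of length `π / 4`, is given by an absolutely summable Fourier series. -/
theorem exists_hasSum_zpow {f : ℝ → ℝ} (hf : ContinuousOn f (Set.Icc 0 (2 * Real.pi)))
    (hs : Summable fun n : ℤ =>
      ‖fourierCoeffOn Real.two_pi_pos (fun t => (f t : ℂ)) n‖) :
    ∃ c : ℤ → ℂ, (Summable fun n => ‖c n‖) ∧ ∀ s ∈ Set.Icc (0 : ℝ) (2 * Real.pi),
      HasSum (fun n : ℤ => c n * Complex.exp (((s / 8 - Real.pi / 2 : ℝ) : ℂ) * Complex.I) ^ n)
        (s + f s * Complex.I) := by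
  have hpos := Real.pi_pos
  obtain ⟨d, hd, hds⟩ := exists_hasSum_exp_eq_self
  set u : ℤ → ℂ := fun n => fourierCoeffOn Real.two_pi_pos (fun t => (f t : ℂ)) n with hu
  -- In terms of the slower angle `s / 8` the frequency `n` of `f` becomes `8 * n`.
  have hinj : Function.Injective fun n : ℤ => 8 * n := fun a b h => by simpa using h
  set v : ℤ → ℂ := Function.extend (fun n : ℤ => 8 * n) u 0 with hv
  have hvu : ∀ n, v (8 * n) = u n := fun n => hinj.extend_apply u 0 n
  have hv0 : ∀ n, n ∉ Set.range (fun n : ℤ => 8 * n) → v n = 0 := fun n hn => by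
    rw [hv, Function.extend_apply' _ _ _ (by simpa using hn)]
    rfl
  have hvs : Summable fun n => ‖v n‖ := by
    refine (hinj.summable_iff fun n hn => by rw [hv0 n hn, norm_zero]).1 ?_
    simpa [Function.comp_def, hvu] using hs
  have hE : ∀ n : ℤ, ‖Complex.exp (n * (Real.pi / 2) * Complex.I)‖ = 1 := fun n => by
    rw [← Complex.norm_exp_ofReal_mul_I (n * (Real.pi / 2))]
    push_cast
    rfl
  refine ⟨fun n => (8 * d n + Complex.I * v n) * Complex.exp (n * (Real.pi / 2) * Complex.I),
    ?_, ?_⟩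
  · simp only [norm_mul, hE, mul_one]
    exact ((hd.of_norm.mul_left 8).add (hvs.of_norm.mul_left Complex.I)).norm
  · intro s hsI
    have h1 := (hds (s / 8) ⟨by linarith [hsI.1], by linarith [hsI.2]⟩).mul_left 8
    have h2 : HasSum (fun n : ℤ => v n * Complex.exp (n * (s / 8 : ℝ) * Complex.I)) (f s) := by
      refine (hinj.hasSum_iff fun n hn => by rw [hv0 n hn, zero_mul]).1 ?_
      convert! hasSum_fourierCoeffOn_two_pi (f := fun t => (f t : ℂ))
        (Complex.continuous_ofReal.comp_continuousOn hf) hs hsI using 2 with n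
      simp only [Function.comp_apply, hvu, hu]
      congr 2
      push_cast
      ring
    convert! h1.add (h2.mul_left Complex.I) using 1
    · funext n
      rw [exp_sub_half_pi_zpow, Complex.exp_neg]
      have := Complex.exp_ne_zero (n * (Real.pi / 2) * Complex.I)
      field_simp
    · push_cast
      ring

/-! ### A walk through the integers -/

/-- A walk on `ℤ` with steps `±1` that visits every integer: between the times `m ^ 2` and
`(m + 1) ^ 2` it runs from one of `m`, `-m` to the other. -/
def walk (j : ℕ) : ℤ := (-1) ^ j.sqrt * ((j : ℤ) - j.sqrt ^ 2 - j.sqrt)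

theorem walk_zero : walk 0 = 0 := by simp [walk]

theorem walk_one : walk 1 = 1 := by simp [walk]

theorem walk_succ (j : ℕ) : walk (j + 1) = walk j + 1 ∨ walk (j + 1) = walk j - 1 := by
  have h1 : j.sqrt * j.sqrt ≤ j := Nat.sqrt_le j
  have h2 : j < (j.sqrt + 1) * (j.sqrt + 1) := Nat.lt_succ_sqrt j
  have hs := neg_one_pow_eq_or ℤ j.sqrt
  rcases Nat.lt_or_ge (j + 1) ((j.sqrt + 1) * (j.sqrt + 1)) with h | h
  · have e : (j + 1).sqrt = j.sqrt := (Nat.eq_sqrt.2 ⟨by omega, h⟩).symm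
    rw [walk, walk, e]
    rcases hs with hs | hs <;> rw [hs] <;> push_cast <;> [left; right] <;> ring
  · have e' : j + 1 = (j.sqrt + 1) * (j.sqrt + 1) := le_antisymm h2 h
    have e : (j + 1).sqrt = j.sqrt + 1 := by rw [e', Nat.sqrt_eq]
    have e'' : (j : ℤ) = (j.sqrt + 1) * (j.sqrt + 1) - 1 := by
      rw [eq_sub_iff_add_eq]
      exact_mod_cast e'
    rw [walk, walk, e, pow_succ]
    push_cast
    generalize (j.sqrt : ℤ) = m at *
    rcases hs with hs | hs <;> rw [hs, e''] <;> [left; right] <;> ring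

theorem exists_walk_succ_eq (z : ℤ) : ∃ j, walk (j + 1) = z := by
  obtain ⟨m, hm⟩ : ∃ m : ℕ, m = 2 * z.natAbs + 2 := ⟨_, rfl⟩
  obtain ⟨j, hj⟩ : ∃ j : ℕ, ((j + 1 : ℕ) : ℤ) = m * m + m + z := by
    refine ⟨(m * m + m + z).toNat - 1, ?_⟩
    have : (2 : ℤ) ≤ m * m + m + z := by nlinarith [sq_nonneg (m : ℤ), abs_le.1 (le_refl |z|)]
    omega
  refine ⟨j, ?_⟩
  have e : (j + 1).sqrt = m := by
    refine (Nat.eq_sqrt.2 ⟨?_, ?_⟩).symm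
    · zify; push_cast at hj; rw [hj]; omega
    · zify; push_cast at hj; rw [hj]; ring_nf; omega
  have he : (-1 : ℤ) ^ m = 1 := Even.neg_one_pow ⟨z.natAbs + 1, by omega⟩
  rw [walk, e, he, hj]
  ring

/-- An absolutely summable family indexed by `ℤ` can be summed along the walk: each coefficient is
spent at one visit, and the other visits contribute nothing. -/
theorem exists_sum_along_walk {c : ℤ → ℂ} (hc : Summable fun n => ‖c n‖) :
    ∃ c' : ℕ → ℂ, (Summable fun j => ‖c' j‖) ∧ ∀ (ζ z : ℂ), HasSum (fun n => c n * ζ ^ n) z →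
      HasSum (fun j => c' j * ζ ^ walk (j + 1)) z := by
  choose g hg using exists_walk_succ_eq
  have hinj : Function.Injective g := fun a b h => by rw [← hg a, ← hg b, h]
  have h1 : ∀ n, Function.extend g c 0 (g n) = c n := fun n => hinj.extend_apply c 0 n
  have h0 : ∀ j, j ∉ Set.range g → Function.extend g c 0 j = 0 := fun j hj => by
    rw [Function.extend_apply' _ _ _ (by simpa using hj)]
    rfl
  refine ⟨Function.extend g c 0, ?_, fun ζ z h => ?_⟩
  · refine (hinj.summable_iff fun n hn => by rw [h0 n hn, norm_zero]).1 ?_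
    simpa [Function.comp_def, h1] using hc
  · refine (hinj.hasSum_iff fun n hn => by rw [h0 n hn, zero_mul]).1 ?_
    simpa [Function.comp_def, h1, hg] using h

/-! ### Similar triangles, parallelograms and the contraparallelogram -/

theorem Attached.mk_of_norm {A B X : unitInterval → ℂ} {d d' : ℝ} (hd : 0 < d) (hd' : 0 < d')
    (hA : ∀ t, ‖X t - A t‖ = d) (hB : ∀ t, ‖X t - B t‖ = d') (hne : ∀ t, A t ≠ B t)
    (area : (∀ t, signedArea (A t) (B t) (X t) = 0) ∨ ∀ t, signedArea (A t) (B t) (X t) ≠ 0) :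
    Attached A B X :=
  ⟨⟨d, hd, fun t => by rw [dist_eq_norm, hA]⟩, ⟨d', hd', fun t => by rw [dist_eq_norm, hB]⟩,
    hne, area⟩

theorem signedArea_of_eq {A B X u a b : ℂ} (hu : ‖u‖ = 1) (h1 : X - A = a * u)
    (h2 : B - A = b * u) : signedArea A B X = (a * (starRingEnd ℂ) b).im := by
  have huu : u * (starRingEnd ℂ) u = 1 := by
    rw [Complex.mul_conj, Complex.normSq_eq_norm_sq, hu]; simp
  rw [signedArea, h1, h2, map_mul, mul_mul_mul_comm, huu, mul_one]

theorem ne_of_signedArea_ne_zero {A B X : ℂ} (h : signedArea A B X ≠ 0) : A ≠ B := fun hAB =>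
  h (by simp [signedArea, hAB])

/-- A point is attached to two others if the triangle they form is rotated about by the unit
vector `u t`. -/
theorem attached_similar {Z u A B X : unitInterval → ℂ} {α β χ : ℂ} (hu : ∀ t, ‖u t‖ = 1)
    (hA : ∀ t, A t = Z t + α * u t) (hB : ∀ t, B t = Z t + β * u t)
    (hX : ∀ t, X t = Z t + χ * u t) (hαβ : α ≠ β) (hα : χ ≠ α) (hβ : χ ≠ β) :
    Attached A B X := by
  have e1 : ∀ t, X t - A t = (χ - α) * u t := fun t => by rw [hX, hA]; ring
  have e2 : ∀ t, X t - B t = (χ - β) * u t := fun t => by rw [hX, hB]; ring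
  have e3 : ∀ t, B t - A t = (β - α) * u t := fun t => by rw [hB, hA]; ring
  have e4 : ∀ t, signedArea (A t) (B t) (X t) = ((χ - α) * (starRingEnd ℂ) (β - α)).im :=
    fun t => signedArea_of_eq (hu t) (e1 t) (e3 t)
  refine Attached.mk_of_norm (norm_pos_iff.2 (sub_ne_zero.2 hα)) (norm_pos_iff.2 (sub_ne_zero.2 hβ))
    (fun t => by rw [e1, norm_mul, hu, mul_one]) (fun t => by rw [e2, norm_mul, hu, mul_one])
    (fun t h => ?_) ?_
  · have hut : u t ≠ 0 := norm_ne_zero_iff.1 (by rw [hu]; exact one_ne_zero)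
    have h' := e3 t
    rw [h, sub_self] at h'
    exact mul_ne_zero (sub_ne_zero.2 hαβ.symm) hut h'.symm
  · by_cases h : ((χ - α) * (starRingEnd ℂ) (β - α)).im = 0
    · exact Or.inl fun t => by rw [e4, h]
    · exact Or.inr fun t => by rw [e4]; exact h

/-- The fourth vertex of a parallelogram that never becomes degenerate is attached to its two
neighbours. -/
theorem attached_parallelogram {Z v w A B X : unitInterval → ℂ} {d d' : ℝ}
    (hA : ∀ t, A t = Z t + v t) (hB : ∀ t, B t = Z t + w t) (hX : ∀ t, X t = Z t + v t + w t)
    (hv : ∀ t, ‖v t‖ = d) (hw : ∀ t, ‖w t‖ = d')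
    (h : ∀ t, (v t * (starRingEnd ℂ) (w t)).im ≠ 0) : Attached A B X := by
  have e1 : ∀ t, X t - A t = w t := fun t => by rw [hX, hA]; ring
  have e2 : ∀ t, X t - B t = v t := fun t => by rw [hX, hB]; ring
  have e4 : ∀ t, signedArea (A t) (B t) (X t) = (v t * (starRingEnd ℂ) (w t)).im := by
    intro t
    have e3 : B t - A t = w t - v t := by rw [hB, hA]; ring
    rw [signedArea, e1, e3]
    simp
    ring
  have hd' : 0 < d' := by
    rw [← hw 0, norm_pos_iff]
    exact fun h0 => h 0 (by simp [h0])
  have hd : 0 < d := by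
    rw [← hv 0, norm_pos_iff]
    exact fun h0 => h 0 (by simp [h0])
  refine Attached.mk_of_norm hd' hd (fun t => by rw [e1, hw]) (fun t => by rw [e2, hv])
    (fun t ht => h t ?_) (Or.inr fun t => by rw [e4]; exact h t)
  have hvw : v t = w t := by simpa [hA, hB] using ht
  rw [hvw, Complex.mul_conj]
  exact Complex.ofReal_im _

/-- In a contraparallelogram with sides in the ratio `2 : 1` and first two bars in the directions
`1` and `q`, the long side opposite to the first bar has the direction `q * contraRotation q`, and
the short side opposite to the second bar has the direction `contraRotation q`. -/
noncomputable def contraRotation (q : ℂ) : ℂ := (q - 2) / (1 - 2 * q)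

theorem one_sub_two_mul_ne_zero {q : ℂ} (hq : ‖q‖ = 1) : 1 - 2 * q ≠ 0 := by
  intro h
  have : ‖(2 : ℂ) * q‖ = 1 := by rw [← sub_eq_zero.1 h, norm_one]
  rw [norm_mul, hq] at this
  norm_num at this

theorem contraRotation_mul {q : ℂ} (hq : ‖q‖ = 1) : contraRotation q * (1 - 2 * q) = q - 2 :=
  div_mul_cancel₀ _ (one_sub_two_mul_ne_zero hq)

theorem re_sq_add_im_sq {q : ℂ} (hq : ‖q‖ = 1) : q.re * q.re + q.im * q.im = 1 := by
  rw [← Complex.normSq_apply, Complex.normSq_eq_norm_sq, hq, one_pow]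

theorem norm_contraRotation {q : ℂ} (hq : ‖q‖ = 1) : ‖contraRotation q‖ = 1 := by
  have h : ‖q - 2‖ = ‖1 - 2 * q‖ := by
    rw [← sq_eq_sq₀ (norm_nonneg _) (norm_nonneg _), Complex.sq_norm, Complex.sq_norm,
      Complex.normSq_apply, Complex.normSq_apply]
    have := re_sq_add_im_sq hq
    simp
    linarith
  rw [contraRotation, norm_div, h, div_self]
  exact norm_ne_zero_iff.2 (one_sub_two_mul_ne_zero hq)

/-- The vertex of a contraparallelogram opposite to `Z`, with first two bars `2 * r * u` and
`r * (u * q)` at `Z`, is attached to the ends of these bars. -/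
theorem attached_contraparallelogram {Z u q A B X : unitInterval → ℂ} {r : ℝ} (hr : 0 < r)
    (hu : ∀ t, ‖u t‖ = 1) (hq : ∀ t, ‖q t‖ = 1) (hq' : ∀ t, (q t).im ≠ 0)
    (hA : ∀ t, A t = Z t + 2 * r * u t) (hB : ∀ t, B t = Z t + r * (u t * q t))
    (hX : ∀ t, X t = Z t + r * (u t * q t) * (1 + 2 * contraRotation (q t))) : Attached A B X := by
  have e1 : ∀ t, X t - A t = r * (u t * contraRotation (q t)) := fun t => by
    rw [hX, hA]
    linear_combination (r * u t : ℂ) * -contraRotation_mul (hq t)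
  have e2 : ∀ t, X t - B t = 2 * r * (u t * q t * contraRotation (q t)) := fun t => by
    rw [hX, hB]
    ring
  have e3 : ∀ t, B t - A t = r * (1 - 2 * q t) * (u t * contraRotation (q t)) := fun t => by
    rw [hB, hA]
    linear_combination (r * u t : ℂ) * -contraRotation_mul (hq t)
  have hn : ‖(r : ℂ)‖ = r := by rw [Complex.norm_real, Real.norm_of_nonneg hr.le]
  have e4 : ∀ t, signedArea (A t) (B t) (X t) = r * (r * (2 * (q t).im)) := fun t => by
    rw [signedArea_of_eq (by rw [norm_mul, hu, norm_contraRotation (hq t), mul_one]) (e1 t) (e3 t)]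
    simp
  have e5 : ∀ t, signedArea (A t) (B t) (X t) ≠ 0 := fun t => by
    rw [e4]
    exact mul_ne_zero hr.ne' (mul_ne_zero hr.ne' (mul_ne_zero two_ne_zero (hq' t)))
  refine Attached.mk_of_norm hr (mul_pos two_pos hr) (fun t => ?_) (fun t => ?_)
    (fun t => ne_of_signedArea_ne_zero (e5 t)) (Or.inr e5)
  · rw [e1, norm_mul, norm_mul, hu, norm_contraRotation (hq t), hn]
    ring
  · rw [e2]
    simp only [norm_mul, hu, hq, norm_contraRotation (hq t), hn]
    norm_num

theorem im_contraRotation_ne_zero {q : ℂ} (hq : ‖q‖ = 1) (hq' : q.im ≠ 0) :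
    (contraRotation q).im ≠ 0 := by
  intro h
  have h1 := congrArg Complex.im (contraRotation_mul hq)
  have h2 := re_sq_add_im_sq (norm_contraRotation hq)
  simp only [Complex.mul_im, Complex.sub_re, Complex.sub_im, Complex.one_im, Complex.one_re,
    Complex.re_ofNat, Complex.im_ofNat, h] at h1
  rw [h] at h2
  have h3 : (contraRotation q).re = -1 / 2 := by
    apply mul_right_cancel₀ hq'
    linarith
  rw [h3] at h2
  norm_num at h2

/-- The contraparallelogram with first two bars `2 * r * u` and `r * (u * q)` at `Z` carries a
similar one, whose third bar at `Z` is the mirror image of the first in the second. -/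
theorem attached_mirror {Z u q A B X : unitInterval → ℂ} {r : ℝ} (hr : 0 < r)
    (hu : ∀ t, ‖u t‖ = 1) (hq : ∀ t, ‖q t‖ = 1) (hq' : ∀ t, (q t).im ≠ 0)
    (hA : ∀ t, A t = Z t)
    (hB : ∀ t, B t = Z t + r * (u t * q t) * (1 + contraRotation (q t) / 2))
    (hX : ∀ t, X t = Z t + r / 2 * (u t * q t * q t)) : Attached A B X := by
  have e1 : ∀ t, X t - A t = (r / 2 : ℝ) * (u t * q t * q t) := fun t => by
    rw [hX, hA]
    push_cast
    ring
  have e2 : ∀ t, X t - B t = -(r * (u t * q t * q t * contraRotation (q t))) := fun t => by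
    rw [hX, hB]
    linear_combination (r * u t * q t / 2 : ℂ) * -contraRotation_mul (hq t)
  have e3 : ∀ t, B t - A t = (r * (1 / 2 + contraRotation (q t))) * (u t * q t * q t) := fun t => by
    rw [hB, hA]
    linear_combination (r * u t * q t / 2 : ℂ) * contraRotation_mul (hq t)
  have hn : ‖(r : ℂ)‖ = r := by rw [Complex.norm_real, Real.norm_of_nonneg hr.le]
  have hn' : ‖((r / 2 : ℝ) : ℂ)‖ = r / 2 := by
    rw [Complex.norm_real, Real.norm_of_nonneg (half_pos hr).le]
  have e4 : ∀ t, signedArea (A t) (B t) (X t) =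
      -(r / 2 * (r * (contraRotation (q t)).im)) := fun t => by
    rw [signedArea_of_eq (by simp only [norm_mul, hu, hq, mul_one]) (e1 t) (e3 t),
      Complex.im_ofReal_mul]
    simp
  have e5 : ∀ t, signedArea (A t) (B t) (X t) ≠ 0 := fun t => by
    rw [e4]
    exact neg_ne_zero.2 (mul_ne_zero (half_pos hr).ne'
      (mul_ne_zero hr.ne' (im_contraRotation_ne_zero (hq t) (hq' t))))
  refine Attached.mk_of_norm (half_pos hr) hr (fun t => ?_) (fun t => ?_)
    (fun t => ne_of_signedArea_ne_zero (e5 t)) (Or.inr e5)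
  · rw [e1]
    simp only [norm_mul, hu, hq, hn', mul_one]
  · rw [e2]
    simp only [norm_neg, norm_mul, hu, hq, norm_contraRotation (hq t), hn, mul_one]

/-! ### The linkage of a trigonometric series -/

/-- The size of the `j`-th block of the linkage. -/
noncomputable def scale (j : ℕ) : ℝ := (1 / 3) ^ j

theorem scale_pos (j : ℕ) : 0 < scale j := by unfold scale; positivity

theorem scale_succ (j : ℕ) : scale (j + 1) = scale j / 3 := by
  rw [scale, scale, pow_succ]; ring

/-- The length of the first of the two displacements whose sum has coefficient `c j`. It is chosen
large, so that the second displacement is nonzero and within the angle `π / 4` of the line of the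
first. -/
noncomputable def detour (c : ℕ → ℂ) (j : ℕ) : ℝ := 2 * ‖c j‖ + scale j

theorem detour_pos (c : ℕ → ℂ) (j : ℕ) : 0 < detour c j := by
  have := scale_pos j
  unfold detour
  positivity

theorem abs_im_lt_re_add_detour (c : ℕ → ℂ) (j : ℕ) : |(c j).im| < (c j).re + detour c j := by
  have h1 := Complex.abs_im_le_norm (c j)
  have h2 := (abs_le.1 (Complex.abs_re_le_norm (c j))).1
  have h3 := scale_pos j
  unfold detour
  linarith

theorem re_add_detour_pos (c : ℕ → ℂ) (j : ℕ) : 0 < (c j).re + detour c j :=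
  (abs_nonneg _).trans_lt (abs_im_lt_re_add_detour c j)

/-- The rotation between the directions with the frequencies of two consecutive blocks. -/
noncomputable def turn (ζ : ℂ) (j : ℕ) : ℂ := ζ ^ (walk (j + 1) - walk j)

theorem zpow_walk_succ {ζ : ℂ} (hζ : ζ ≠ 0) (j : ℕ) :
    ζ ^ walk (j + 1) = ζ ^ walk j * turn ζ j := by
  rw [turn, ← zpow_add₀ hζ]
  congr 1
  ring

theorem turn_eq {ζ : ℂ} (hζ : ‖ζ‖ = 1) (j : ℕ) :
    turn ζ j = ζ ∨ turn ζ j = (starRingEnd ℂ) ζ := by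
  rcases walk_succ j with h | h
  · left
    rw [turn, h, add_sub_cancel_left, zpow_one]
  · right
    rw [turn, h, sub_sub_cancel_left, zpow_neg_one, Complex.inv_eq_conj hζ]

theorem norm_turn {ζ : ℂ} (hζ : ‖ζ‖ = 1) (j : ℕ) : ‖turn ζ j‖ = 1 := by
  rw [turn, norm_zpow, hζ, one_zpow]

theorem im_turn_ne_zero {ζ : ℂ} (hζ : ‖ζ‖ = 1) (h : ζ.im ≠ 0) (j : ℕ) : (turn ζ j).im ≠ 0 := by
  rcases turn_eq hζ j with e | e <;> simpa [e] using h

theorem abs_re_turn_le {ζ : ℂ} (hζ : ‖ζ‖ = 1) (h : |ζ.re| ≤ |ζ.im|) (j : ℕ) :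
    |(turn ζ j).re| ≤ |(turn ζ j).im| := by
  rcases turn_eq hζ j with e | e <;> simpa [e] using h

/-- The position of the central joint of the `j`-th block: a partial sum of the series. -/
noncomputable def joint (c : ℕ → ℂ) (ζ : ℂ) (j : ℕ) : ℂ :=
  1 + ζ + ∑ i ∈ Finset.range j, c i * ζ ^ walk (i + 1)

/-- The position, relative to the central joint `0`, of the vertex `r` of the `j`-th block. With the
frequencies `k`, `l`, `m` of three consecutive steps of the walk, the vertices `1` and `2` are the
ends of bars in the directions `ζ ^ k` and `ζ ^ l`; the vertices `3`, `4`, `5` reflect the first bar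
in the second; `6` is the end of a bar in the direction `ζ ^ m`; `7` is the central joint after the
first displacement, and `8`, `9` are the ends of bars at `7` in the directions `-ζ ^ l` and
`ζ ^ m`. -/
noncomputable def offset (c : ℕ → ℂ) (ζ : ℂ) (j : ℕ) : ℕ → ℂ
  | 0 => 0
  | 1 => 2 * scale j * ζ ^ walk j
  | 2 => scale j * ζ ^ walk (j + 1)
  | 3 => scale j * ζ ^ walk (j + 1) * (1 + 2 * contraRotation (turn ζ j))
  | 4 => scale j * ζ ^ walk (j + 1) * (1 + contraRotation (turn ζ j) / 2)
  | 5 => scale j / 2 * (ζ ^ walk (j + 1) * turn ζ j)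
  | 6 => scale (j + 1) * ζ ^ walk (j + 2)
  | 7 => -detour c j * ζ ^ walk (j + 1)
  | 8 => -(detour c j + scale (j + 1)) * ζ ^ walk (j + 1)
  | _ => -detour c j * ζ ^ walk (j + 1) + scale (j + 1) * ζ ^ walk (j + 2)

/-- The number of the vertex `r < 10` of the `j`-th block. -/
def blockVertex (j r : ℕ) : ℕ := 10 * j + r + 3

/-- The positions of all vertices of the linkage, as functions of the direction `ζ` of the driving
bar. -/
noncomputable def position (c : ℕ → ℂ) (ζ : ℂ) : ℕ → ℂ
  | 0 => 0
  | 1 => 1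
  | 2 => ζ
  | n + 3 => joint c ζ (n / 10) + offset c ζ (n / 10) (n % 10)

/-- The first vertex to which the vertex `r` of the block `j` is attached. -/
def leftBlockParent : ℕ → ℕ → ℕ
  | 0, 0 => 1
  | 1, 0 => 2
  | 2, 0 => 1
  | 0, j + 1 => blockVertex j 7
  | 1, j + 1 => blockVertex j 7
  | 2, j + 1 => blockVertex (j + 1) 0
  | 3, j => blockVertex j 1
  | 4, j => blockVertex j 2
  | 9, j => blockVertex j 7
  | _, j => blockVertex j 0

/-- The second vertex to which the vertex `r` of the block `j` is attached. -/
def rightBlockParent : ℕ → ℕ → ℕ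
  | 0, 0 => 2
  | 1, 0 => blockVertex 0 0
  | 2, 0 => blockVertex 0 0
  | 0, j + 1 => blockVertex j 8
  | 1, j + 1 => blockVertex (j + 1) 0
  | 2, j + 1 => blockVertex j 9
  | 3, j => blockVertex j 2
  | 4, j => blockVertex j 3
  | 5, j => blockVertex j 4
  | 6, j => if walk (j + 2) = walk j then blockVertex j 1 else blockVertex j 5
  | 7, j => blockVertex j 2
  | 8, j => blockVertex j 7
  | _, j => blockVertex j 6

/-- The first vertex to which a vertex is attached. -/
def leftParent : ℕ → ℕ
  | n + 3 => leftBlockParent (n % 10) (n / 10)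
  | _ => 0

/-- The second vertex to which a vertex is attached. -/
def rightParent : ℕ → ℕ
  | n + 3 => rightBlockParent (n % 10) (n / 10)
  | _ => 0

theorem position_blockVertex (c : ℕ → ℂ) (ζ : ℂ) (j : ℕ) {r : ℕ} (hr : r < 10) :
    position c ζ (blockVertex j r) = joint c ζ j + offset c ζ j r := by
  have e1 : (10 * j + r) / 10 = j := by omega
  have e2 : (10 * j + r) % 10 = r := by omega
  rw [blockVertex, position, e1, e2]

theorem leftParent_blockVertex (j : ℕ) {r : ℕ} (hr : r < 10) :
    leftParent (blockVertex j r) = leftBlockParent r j := by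
  have e1 : (10 * j + r) / 10 = j := by omega
  have e2 : (10 * j + r) % 10 = r := by omega
  rw [blockVertex, leftParent, e1, e2]

theorem rightParent_blockVertex (j : ℕ) {r : ℕ} (hr : r < 10) :
    rightParent (blockVertex j r) = rightBlockParent r j := by
  have e1 : (10 * j + r) / 10 = j := by omega
  have e2 : (10 * j + r) % 10 = r := by omega
  rw [blockVertex, rightParent, e1, e2]

theorem exists_eq_blockVertex {n : ℕ} (hn : 3 ≤ n) : ∃ j r, r < 10 ∧ n = blockVertex j r :=
  ⟨(n - 3) / 10, (n - 3) % 10, Nat.mod_lt _ (by norm_num), by unfold blockVertex; omega⟩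

theorem leftParent_bounds {n : ℕ} (hn : 3 ≤ n) :
    leftParent n < n ∧ n ≤ leftParent n + 20 ∧ leftParent n ≠ 0 := by
  obtain ⟨j, r, hr, rfl⟩ := exists_eq_blockVertex hn
  rw [leftParent_blockVertex j hr]
  cases j <;> interval_cases r <;> simp only [leftBlockParent, blockVertex] <;> omega

theorem rightParent_bounds {n : ℕ} (hn : 3 ≤ n) :
    rightParent n < n ∧ n ≤ rightParent n + 20 ∧ rightParent n ≠ 0 := by
  obtain ⟨j, r, hr, rfl⟩ := exists_eq_blockVertex hn
  rw [rightParent_blockVertex j hr]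
  cases j <;> interval_cases r <;> simp only [rightBlockParent, blockVertex] <;>
    (try split_ifs) <;> omega

theorem im_mul_conj_rotate {u y q : ℂ} (hu : ‖u‖ = 1) (r : ℝ) :
    (y * u * (starRingEnd ℂ) (r * (u * q))).im = r * (y.im * q.re - y.re * q.im) := by
  have huu : u * (starRingEnd ℂ) u = 1 := by
    rw [Complex.mul_conj, Complex.normSq_eq_norm_sq, hu]; simp
  have e : y * u * (starRingEnd ℂ) (r * (u * q)) = r * (y * (starRingEnd ℂ) q) := by
    simp only [map_mul, Complex.conj_ofReal]
    linear_combination (y * r * (starRingEnd ℂ) q) * huu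
  rw [e, Complex.im_ofReal_mul]
  simp
  ring_nf
  simp

/-- Two directions are not parallel if the first is within `π / 4` of the real axis and the second
is not. -/
theorem im_mul_re_sub_ne_zero {y q : ℂ} (hy : |y.im| < y.re) (hq : |q.re| ≤ |q.im|)
    (hq' : q.im ≠ 0) : y.im * q.re - y.re * q.im ≠ 0 := by
  intro h
  have h1 : |y.im| * |q.re| = y.re * |q.im| := by
    rw [← abs_mul, sub_eq_zero.1 h, abs_mul, abs_of_pos ((abs_nonneg _).trans_lt hy)]
  have h2 : |y.im| * |q.re| ≤ |y.im| * |q.im| := mul_le_mul_of_nonneg_left hq (abs_nonneg _)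
  have h3 : |y.im| * |q.im| < y.re * |q.im| := mul_lt_mul_of_pos_right hy (abs_pos.2 hq')
  linarith

theorem ne_of_re_lt {z w : ℂ} (h : z.re < w.re) : z ≠ w := fun e => h.ne (by rw [e])

/-- In each of the blocks, every vertex is attached to its two parents. -/
theorem attached_position {ζ : unitInterval → ℂ} (c : ℕ → ℂ)
    (hn : ∀ t, ‖ζ t‖ = 1) (hi : ∀ t, (ζ t).im ≠ 0) (hri : ∀ t, |(ζ t).re| ≤ |(ζ t).im|) {n : ℕ}
    (h3 : 3 ≤ n) :
    Attached (fun t => position c (ζ t) (leftParent n)) (fun t => position c (ζ t) (rightParent n))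
      (fun t => position c (ζ t) n) := by
  have h0 : ∀ t, ζ t ≠ 0 := fun t => norm_ne_zero_iff.1 (by rw [hn]; exact one_ne_zero)
  have hu : ∀ k : ℤ, ∀ t, ‖ζ t ^ k‖ = 1 := fun k t => by rw [norm_zpow, hn, one_zpow]
  have hqn := fun j t => norm_turn (hn t) j
  have hqi := fun j t => im_turn_ne_zero (hn t) (hi t) j
  have hsc := scale_pos
  obtain ⟨j, r, hr, rfl⟩ := exists_eq_blockVertex h3
  have P : ∀ j r, r < 10 → ∀ t, position c (ζ t) (blockVertex j r) =
    joint c (ζ t) j + offset c (ζ t) j r := fun j r hr t => position_blockVertex c (ζ t) j hr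
  rw [leftParent_blockVertex j hr, rightParent_blockVertex j hr]
  have hs := hsc j
  have hs' := hsc (j + 1)
  have hss := scale_succ j
  have hd := detour_pos c j
  interval_cases r
  -- The first central joint completes a parallelogram; a later one moves rigidly with `7` and `8`
  -- of the block before.
  · rcases j with _ | j
    · refine attached_parallelogram (Z := fun _ => 0) (v := fun _ => 1) (w := ζ) (d := 1) (d' := 1)
        (fun t => ?_) (fun t => ?_) (fun t => ?_) (fun t => norm_one) hn (fun t => ?_)
      · simp [leftBlockParent, position]
      · simp [rightBlockParent, position]
      · simp only [P 0 0 (by norm_num), joint, offset]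
        simp
      · simpa using hi t
    · have hs := hsc (j + 1)
      have hy := re_add_detour_pos c j
      refine attached_similar (Z := fun t => joint c (ζ t) j) (u := fun t => ζ t ^ walk (j + 1))
        (α := -detour c j) (β := -(detour c j + scale (j + 1))) (χ := c j)
        (hu _) (fun t => ?_) (fun t => ?_) (fun t => ?_) ?_ ?_ ?_
      · simp only [leftBlockParent, P j 7 (by norm_num), offset]
      · simp only [rightBlockParent, P j 8 (by norm_num), offset]
      · simp only [P (j + 1) 0 (by norm_num), offset, joint, Finset.sum_range_succ]
        ring
      · refine (ne_of_re_lt ?_).symm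
        simp
        linarith
      · refine (ne_of_re_lt ?_).symm
        simp
        linarith
      · refine (ne_of_re_lt ?_).symm
        simp
        linarith
  -- The end of the first bar lies rigidly on a bar at the joint `0`: the one to the joint before the
  -- second displacement or, in the first block, the one to the vertex `2` of the base.
  · rcases j with _ | j
    · refine attached_similar (Z := ζ) (u := fun _ => 1) (α := 0) (β := 1) (χ := 1 + 2 * scale 0)
        (fun _ => norm_one) (fun t => ?_) (fun t => ?_) (fun t => ?_) zero_ne_one ?_ ?_
      · simp [leftBlockParent, position]
      · simp only [rightBlockParent, P 0 0 (by norm_num), joint, offset]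
        simp
        ring
      · simp only [P 0 1 (by norm_num), joint, offset, walk_zero]
        simp
        ring
      · refine (ne_of_re_lt ?_).symm
        simp
        linarith
      · refine (ne_of_re_lt ?_).symm
        simp
        linarith
    · have hs := hsc (j + 1)
      have hy := re_add_detour_pos c j
      refine attached_similar (Z := fun t => joint c (ζ t) j) (u := fun t => ζ t ^ walk (j + 1))
        (α := -detour c j) (β := c j) (χ := c j + 2 * scale (j + 1))
        (hu _) (fun t => ?_) (fun t => ?_) (fun t => ?_) ?_ ?_ ?_
      · simp only [leftBlockParent, P j 7 (by norm_num), offset]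
      · simp only [rightBlockParent, P (j + 1) 0 (by norm_num), offset, joint,
          Finset.sum_range_succ]
        ring
      · simp only [P (j + 1) 1 (by norm_num), offset, joint, Finset.sum_range_succ]
        ring
      · refine ne_of_re_lt ?_
        simp
        linarith
      · refine (ne_of_re_lt ?_).symm
        simp
        linarith
      · refine (ne_of_re_lt ?_).symm
        simp
        linarith
  -- The second bar is translated by the second displacement. The parallelogram stays
  -- nondegenerate as this displacement makes an angle below `π / 4` with `ζ ^ l`, while the bar
  -- makes an angle of at least `π / 4` with that line.
  · rcases j with _ | j
    · refine attached_similar (Z := fun _ => 1) (u := ζ) (α := 0) (β := 1) (χ := 1 + scale 0)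
        hn (fun t => ?_) (fun t => ?_) (fun t => ?_) zero_ne_one ?_ ?_
      · simp [leftBlockParent, position]
      · simp only [rightBlockParent, P 0 0 (by norm_num), joint, offset]
        simp
      · simp only [P 0 2 (by norm_num), joint, offset, zero_add, walk_one]
        simp
        ring
      · refine (ne_of_re_lt ?_).symm
        simp
        linarith
      · refine (ne_of_re_lt ?_).symm
        simp
        linarith
    · have hy := abs_im_lt_re_add_detour c j
      refine attached_parallelogram
        (Z := fun t => joint c (ζ t) j + -detour c j * ζ t ^ walk (j + 1))
        (v := fun t => (c j + detour c j) * ζ t ^ walk (j + 1))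
        (w := fun t => scale (j + 1) * (ζ t ^ walk (j + 1) * turn (ζ t) (j + 1)))
        (d := ‖c j + detour c j‖) (d' := scale (j + 1))
        (fun t => ?_) (fun t => ?_) (fun t => ?_) (fun t => ?_) (fun t => ?_) (fun t => ?_)
      · simp only [leftBlockParent, P (j + 1) 0 (by norm_num), offset, joint,
          Finset.sum_range_succ]
        ring
      · simp only [rightBlockParent, P j 9 (by norm_num), offset, zpow_walk_succ (h0 t) (j + 1)]
        ring
      · simp only [P (j + 1) 2 (by norm_num), offset, joint, Finset.sum_range_succ,
          zpow_walk_succ (h0 t) (j + 1)]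
        ring
      · rw [norm_mul, hu, mul_one]
      · rw [norm_mul, norm_mul, hu, hqn, mul_one, mul_one, Complex.norm_real,
          Real.norm_of_nonneg (hsc _).le]
      · rw [im_mul_conj_rotate (hu _ t)]
        exact mul_ne_zero (hsc _).ne' (im_mul_re_sub_ne_zero (by simpa using hy)
          (abs_re_turn_le (hn t) (hri t) _) (hqi _ t))
  -- The vertices `3`, `4`, `5`: two similar contraparallelograms with a common bar from `2` to `3`.
  · refine attached_contraparallelogram (Z := fun t => joint c (ζ t) j)
      (u := fun t => ζ t ^ walk j) (q := fun t => turn (ζ t) j) hs (hu _) (hqn j) (hqi j)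
      (fun t => ?_) (fun t => ?_) (fun t => ?_)
    · simp only [leftBlockParent, P j 1 (by norm_num), offset]
    · simp only [rightBlockParent, P j 2 (by norm_num), offset, zpow_walk_succ (h0 t) j]
    · simp only [P j 3 (by norm_num), offset, zpow_walk_succ (h0 t) j]
  · refine attached_similar (Z := fun t => joint c (ζ t) j + scale j * ζ t ^ walk (j + 1))
      (u := fun t => ζ t ^ walk (j + 1) * contraRotation (turn (ζ t) j))
      (α := 0) (β := 2 * scale j) (χ := scale j / 2)
      (fun t => ?_) (fun t => ?_) (fun t => ?_) (fun t => ?_) ?_ ?_ ?_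
    · rw [norm_mul, hu, norm_contraRotation (hqn j t), mul_one]
    · simp only [leftBlockParent, P j 2 (by norm_num), offset]
      ring
    · simp only [rightBlockParent, P j 3 (by norm_num), offset]
      ring
    · simp only [P j 4 (by norm_num), offset]
      ring
    · refine ne_of_re_lt ?_
      simp
      linarith
    · refine (ne_of_re_lt ?_).symm
      simp
      linarith
    · refine ne_of_re_lt ?_
      simp
      linarith
  · refine attached_mirror (Z := fun t => joint c (ζ t) j)
      (u := fun t => ζ t ^ walk j) (q := fun t => turn (ζ t) j) hs (hu _) (hqn j) (hqi j)
      (fun t => ?_) (fun t => ?_) (fun t => ?_)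
    · simp only [leftBlockParent, P j 0 (by norm_num), offset, add_zero]
    · simp only [rightBlockParent, P j 4 (by norm_num), offset, zpow_walk_succ (h0 t) j]
    · simp only [P j 5 (by norm_num), offset, zpow_walk_succ (h0 t) j]
  -- The walk either turns back, and the next frequency is that of the first bar, or it goes on, and
  -- the next frequency is that of the reflected bar.
  · by_cases hw : walk (j + 2) = walk j
    · refine attached_similar (Z := fun t => joint c (ζ t) j) (u := fun t => ζ t ^ walk j)
        (α := 0) (β := 2 * scale j) (χ := scale (j + 1))
        (hu _) (fun t => ?_) (fun t => ?_) (fun t => ?_) ?_ ?_ ?_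
      · simp only [leftBlockParent, P j 0 (by norm_num), offset]
        ring
      · simp only [rightBlockParent, if_pos hw, P j 1 (by norm_num), offset]
      · simp only [P j 6 (by norm_num), offset, hw]
      · refine ne_of_re_lt ?_
        simp
        linarith
      · refine (ne_of_re_lt ?_).symm
        simp
        linarith
      · refine ne_of_re_lt ?_
        simp
        linarith
    · have hw' : walk (j + 2) = walk (j + 1) + (walk (j + 1) - walk j) := by
        have h1 := walk_succ j
        have h2 := walk_succ (j + 1)
        simp only [add_assoc, one_add_one_eq_two] at h2
        omega
      have hE : ∀ t, ζ t ^ walk (j + 2) = ζ t ^ walk (j + 1) * turn (ζ t) j := fun t => by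
        rw [hw', zpow_add₀ (h0 t), turn]
      refine attached_similar (Z := fun t => joint c (ζ t) j) (u := fun t => ζ t ^ walk (j + 2))
        (α := 0) (β := scale j / 2) (χ := scale (j + 1))
        (hu _) (fun t => ?_) (fun t => ?_) (fun t => ?_) ?_ ?_ ?_
      · simp only [leftBlockParent, P j 0 (by norm_num), offset]
        ring
      · simp only [rightBlockParent, if_neg hw, P j 5 (by norm_num), offset, hE t]
      · simp only [P j 6 (by norm_num), offset]
      · refine ne_of_re_lt ?_
        simp
        linarith
      · refine (ne_of_re_lt ?_).symm
        simp
        linarith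
      · refine ne_of_re_lt ?_
        simp
        linarith
  -- The vertices `7`, `8` lie on the line of the second bar, and `9` translates the bar to `6`.
  · refine attached_similar (Z := fun t => joint c (ζ t) j) (u := fun t => ζ t ^ walk (j + 1))
      (α := 0) (β := scale j) (χ := -detour c j)
      (hu _) (fun t => ?_) (fun t => ?_) (fun t => ?_) ?_ ?_ ?_
    · simp only [leftBlockParent, P j 0 (by norm_num), offset]
      ring
    · simp only [rightBlockParent, P j 2 (by norm_num), offset]
    · simp only [P j 7 (by norm_num), offset]
    · refine ne_of_re_lt ?_
      simp
      linarith
    · refine ne_of_re_lt ?_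
      simp
      linarith
    · refine ne_of_re_lt ?_
      simp
      linarith
  · refine attached_similar (Z := fun t => joint c (ζ t) j) (u := fun t => ζ t ^ walk (j + 1))
      (α := 0) (β := -detour c j) (χ := -(detour c j + scale (j + 1)))
      (hu _) (fun t => ?_) (fun t => ?_) (fun t => ?_) ?_ ?_ ?_
    · simp only [leftBlockParent, P j 0 (by norm_num), offset]
      ring
    · simp only [rightBlockParent, P j 7 (by norm_num), offset]
    · simp only [P j 8 (by norm_num), offset]
    · refine (ne_of_re_lt ?_).symm
      simp
      linarith
    · refine ne_of_re_lt ?_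
      simp
      linarith
    · refine ne_of_re_lt ?_
      simp
      linarith
  · refine attached_parallelogram (Z := fun t => joint c (ζ t) j)
      (v := fun t => -detour c j * ζ t ^ walk (j + 1))
      (w := fun t => scale (j + 1) * (ζ t ^ walk (j + 1) * turn (ζ t) (j + 1)))
      (d := detour c j) (d' := scale (j + 1))
      (fun t => ?_) (fun t => ?_) (fun t => ?_) (fun t => ?_) (fun t => ?_) (fun t => ?_)
    · simp only [leftBlockParent, P j 7 (by norm_num), offset]
    · simp only [rightBlockParent, P j 6 (by norm_num), offset, zpow_walk_succ (h0 t) (j + 1)]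
    · simp only [P j 9 (by norm_num), offset, zpow_walk_succ (h0 t) (j + 1)]
      ring
    · rw [norm_mul, hu, norm_neg, mul_one, Complex.norm_real, Real.norm_of_nonneg hd.le]
    · rw [norm_mul, norm_mul, hu, hqn, mul_one, mul_one, Complex.norm_real,
        Real.norm_of_nonneg (hsc _).le]
    · rw [im_mul_conj_rotate (hu _ t)]
      refine mul_ne_zero (hsc _).ne' ?_
      simpa using ⟨hd.ne', hqi (j + 1) t⟩

theorem continuous_position {ζ : unitInterval → ℂ} (c : ℕ → ℂ) (hc : Continuous ζ)
    (hn : ∀ t, ‖ζ t‖ = 1) (n : ℕ) :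
    Continuous fun t => position c (ζ t) n := by
  have h0 : ∀ t, ζ t ≠ 0 := fun t => norm_ne_zero_iff.1 (by rw [hn]; exact one_ne_zero)
  have hz : ∀ k : ℤ, Continuous fun t => ζ t ^ k := fun k => hc.zpow₀ k fun t => Or.inl (h0 t)
  have hq : ∀ j, Continuous fun t => turn (ζ t) j := fun j => hz _
  have hx : ∀ j, Continuous fun t => contraRotation (turn (ζ t) j) := fun j =>
    ((hq j).sub continuous_const).div (continuous_const.sub (continuous_const.mul (hq j)))
      fun t => one_sub_two_mul_ne_zero (norm_turn (hn t) j)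
  have hJ : ∀ j, Continuous fun t => joint c (ζ t) j := fun j => by
    unfold joint
    exact (continuous_const.add hc).add (continuous_finsetSum _ fun i _ =>
      continuous_const.mul (hz _))
  by_cases h3 : 3 ≤ n
  · obtain ⟨j, r, hr, rfl⟩ := exists_eq_blockVertex h3
    simp only [position_blockVertex c _ j hr]
    refine (hJ j).add ?_
    interval_cases r <;> simp only [offset] <;> fun_prop
  · have : n = 0 ∨ n = 1 ∨ n = 2 := by omega
    rcases this with rfl | rfl | rfl
    exacts [continuous_const, continuous_const, hc]

theorem attachedSystem_position {ζ : unitInterval → ℂ} (c : ℕ → ℂ) (hc : Continuous ζ)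
    (hn : ∀ t, ‖ζ t‖ = 1)
    (hi : ∀ t, (ζ t).im ≠ 0) (hri : ∀ t, |(ζ t).re| ≤ |(ζ t).im|)
    (hmono : StrictMono fun t => (ζ t).re) :
    AttachedSystem (fun t => position c (ζ t)) leftParent rightParent where
  continuous := continuous_position c hc hn
  attached _ h3 := attached_position c hn hi hri h3
  lt_left n h1 := by
    by_cases h3 : 3 ≤ n
    · exact (leftParent_bounds h3).1
    · have : n = 1 ∨ n = 2 := by omega
      rcases this with rfl | rfl <;> simp [leftParent]
  lt_right n h1 := by
    by_cases h3 : 3 ≤ n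
    · exact (rightParent_bounds h3).1
    · have : n = 1 ∨ n = 2 := by omega
      rcases this with rfl | rfl <;> simp [rightParent]
  near_left n := by
    by_cases h3 : 3 ≤ n
    · exact (leftParent_bounds h3).2.1
    · omega
  near_right n := by
    by_cases h3 : 3 ≤ n
    · exact (rightParent_bounds h3).2.1
    · omega
  base_left := ⟨rfl, rfl⟩
  base_right := ⟨rfl, rfl⟩
  ne_left _ h3 := (leftParent_bounds h3).2.2
  ne_right _ h3 := (rightParent_bounds h3).2.2
  zero _ := rfl
  one _ := rfl
  two := hn
  strictMono := hmono

theorem norm_offset_le (c : ℕ → ℂ) {ζ : ℂ} (hζ : ‖ζ‖ = 1) (j : ℕ) {r : ℕ} (hr : r < 10) :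
    ‖offset c ζ j r‖ ≤ 3 * (scale j + detour c j) := by
  have hu : ∀ k : ℤ, ‖ζ ^ k‖ = 1 := fun k => by rw [norm_zpow, hζ, one_zpow]
  have hq := norm_turn hζ j
  have hx := norm_contraRotation hq
  have hs := scale_pos j
  have hs' := scale_pos (j + 1)
  have hss := scale_succ j
  have hd := detour_pos c j
  have n1 : ‖(scale j : ℂ)‖ = scale j := by rw [Complex.norm_real, Real.norm_of_nonneg hs.le]
  have n2 : ‖(scale (j + 1) : ℂ)‖ = scale (j + 1) := by
    rw [Complex.norm_real, Real.norm_of_nonneg hs'.le]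
  have n3 : ‖(detour c j : ℂ)‖ = detour c j := by rw [Complex.norm_real, Real.norm_of_nonneg hd.le]
  have n4 : ‖(1 : ℂ) + 2 * contraRotation (turn ζ j)‖ ≤ 3 := (norm_add_le _ _).trans (by
    rw [norm_mul, hx]; norm_num)
  have n5 : ‖(1 : ℂ) + contraRotation (turn ζ j) / 2‖ ≤ 3 := (norm_add_le _ _).trans (by
    rw [norm_div, hx]; norm_num)
  interval_cases r
  · simp only [offset, norm_zero]
    positivity
  · simp only [offset, norm_mul, hu, n1]
    norm_num
    linarith
  · simp only [offset, norm_mul, hu, n1]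
    linarith
  · simp only [offset, norm_mul, hu, n1, mul_one]
    nlinarith
  · simp only [offset, norm_mul, hu, n1, mul_one]
    nlinarith
  · simp only [offset, norm_mul, norm_div, hu, hq, n1, mul_one]
    norm_num
    linarith
  · simp only [offset, norm_mul, hu, n2]
    linarith
  · simp only [offset, norm_mul, norm_neg, hu, n3]
    linarith
  · simp only [offset, norm_mul, norm_neg, hu, mul_one]
    refine (norm_add_le _ _).trans ?_
    rw [n2, n3]
    linarith
  · simp only [offset]
    refine (norm_add_le _ _).trans ?_
    simp only [norm_mul, norm_neg, hu, n2, n3]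
    linarith

theorem tendsto_offset_bound {c : ℕ → ℂ} (hc : Summable fun j => ‖c j‖) :
    Tendsto (fun j => 3 * (scale j + detour c j)) atTop (𝓝 0) := by
  have hs : Tendsto scale atTop (𝓝 0) :=
    tendsto_pow_atTop_nhds_zero_of_lt_one (by norm_num) (by norm_num)
  have h := (hs.add ((hc.tendsto_atTop_zero.const_mul 2).add hs)).const_mul 3
  simpa only [add_zero, mul_zero, detour] using h

/-- The vertices converge to the sum of the series. -/
theorem tendsto_position {c : ℕ → ℂ} (hc : Summable fun j => ‖c j‖) {ζ z : ℂ} (hζ : ‖ζ‖ = 1)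
    (hz : HasSum (fun j => c j * ζ ^ walk (j + 1)) (z - 1 - ζ)) :
    Tendsto (position c ζ) atTop (𝓝 z) := by
  rw [← tendsto_add_atTop_iff_nat 3]
  have hdiv : Tendsto (fun n : ℕ => n / 10) atTop atTop :=
    Nat.tendsto_div_const_atTop (by norm_num)
  have h1 : Tendsto (joint c ζ) atTop (𝓝 z) := by
    have := (tendsto_const_nhds (x := 1 + ζ)).add hz.tendsto_sum_nat
    rwa [show 1 + ζ + (z - 1 - ζ) = z by ring] at this
  have h2 : Tendsto (fun n => offset c ζ (n / 10) (n % 10)) atTop (𝓝 0) :=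
    squeeze_zero_norm (fun n => norm_offset_le c hζ (n / 10) (Nat.mod_lt n (by norm_num)))
      ((tendsto_offset_bound hc).comp hdiv)
  simpa only [position, add_zero, Function.comp_def] using (h1.comp hdiv).add h2

/-! ### The driving bar -/

/-- The direction of the driving bar at the time `t`; its angle grows from `-π / 2` to `-π / 4`. -/
noncomputable def driver (t : unitInterval) : ℂ :=
  Complex.exp (((2 * Real.pi * t / 8 - Real.pi / 2 : ℝ) : ℂ) * Complex.I)

theorem norm_driver (t : unitInterval) : ‖driver t‖ = 1 := Complex.norm_exp_ofReal_mul_I _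

theorem continuous_driver : Continuous driver := by
  unfold driver
  fun_prop

theorem re_driver (t : unitInterval) : (driver t).re = Real.sin (Real.pi * t / 4) := by
  rw [driver, Complex.exp_ofReal_mul_I_re, Real.cos_sub_pi_div_two]
  congr 1
  ring

theorem im_driver (t : unitInterval) : (driver t).im = -Real.cos (Real.pi * t / 4) := by
  rw [driver, Complex.exp_ofReal_mul_I_im, Real.sin_sub_pi_div_two]
  congr 2
  ring

theorem driver_angle_mem (t : unitInterval) :
    0 ≤ Real.pi * t / 4 ∧ Real.pi * t / 4 ≤ Real.pi / 4 := by
  have h0 := t.2.1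
  have h1 := t.2.2
  have := Real.pi_pos
  constructor
  · positivity
  · nlinarith

theorem im_driver_ne_zero (t : unitInterval) : (driver t).im ≠ 0 := by
  obtain ⟨h0, h1⟩ := driver_angle_mem t
  have := Real.pi_pos
  rw [im_driver]
  exact neg_ne_zero.2 (Real.cos_pos_of_mem_Ioo ⟨by linarith, by linarith⟩).ne'

theorem abs_re_driver_le (t : unitInterval) : |(driver t).re| ≤ |(driver t).im| := by
  obtain ⟨h0, h1⟩ := driver_angle_mem t
  have := Real.pi_pos
  rw [re_driver, im_driver, abs_neg,
    abs_of_nonneg (Real.sin_nonneg_of_nonneg_of_le_pi h0 (by linarith)),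
    abs_of_nonneg (Real.cos_nonneg_of_mem_Icc ⟨by linarith, by linarith⟩),
    ← Real.sin_pi_div_two_sub]
  exact Real.sin_le_sin_of_le_of_le_pi_div_two (by linarith) (by linarith) (by linarith)

theorem strictMono_re_driver : StrictMono fun t => (driver t).re := by
  intro s t hst
  obtain ⟨h0, -⟩ := driver_angle_mem s
  obtain ⟨-, h1⟩ := driver_angle_mem t
  have := Real.pi_pos
  have hst' : (s : ℝ) < t := hst
  simp only [re_driver]
  refine Real.sin_lt_sin_of_lt_of_le_pi_div_two (by linarith) (by linarith) ?_
  nlinarith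

theorem hasSum_ite_mul_zpow (ζ : ℂ) (k : ℤ) :
    HasSum (fun n : ℤ => (if n = k then (1 : ℂ) else 0) * ζ ^ n) (ζ ^ k) := by
  convert hasSum_ite_eq k (ζ ^ k) using 2 with n
  split_ifs with h
  · rw [h, one_mul]
  · rw [zero_mul]

/-- The series that the linkage has to sum: the graph of `f` as a curve in the complex plane, less
the position `1 + ζ` of the first central joint. -/
theorem exists_hasSum_driver {f : ℝ → ℝ} (hf : ContinuousOn f (Set.Icc 0 (2 * Real.pi)))
    (hs : Summable fun n : ℤ =>
      ‖fourierCoeffOn Real.two_pi_pos (fun t => (f t : ℂ)) n‖) :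
    ∃ c : ℕ → ℂ, (Summable fun j => ‖c j‖) ∧ ∀ t : unitInterval,
      HasSum (fun j => c j * driver t ^ walk (j + 1))
        (((2 * Real.pi * t : ℝ) + f (2 * Real.pi * t) * Complex.I) - 1 - driver t) := by
  obtain ⟨c, hc, h⟩ := exists_hasSum_zpow hf hs
  have hite : ∀ k : ℤ, Summable fun n : ℤ => if n = k then (1 : ℂ) else 0 := fun k =>
    (hasSum_ite_eq k (1 : ℂ)).summable
  obtain ⟨c', hc', h'⟩ := exists_sum_along_walk
    ((hc.of_norm.sub (hite 0)).sub (hite 1)).norm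
  refine ⟨c', hc', fun t => h' _ _ ?_⟩
  have ht : 2 * Real.pi * (t : ℝ) ∈ Set.Icc 0 (2 * Real.pi) := by
    have h0 := t.2.1
    have h1 := t.2.2
    have := Real.pi_pos
    exact ⟨by positivity, by nlinarith⟩
  convert! ((h _ ht).sub (hasSum_ite_mul_zpow (driver t) 0)).sub (hasSum_ite_mul_zpow (driver t) 1)
    using 1
  · funext n
    rw [sub_mul, sub_mul]
    rfl
  · rw [zpow_zero, zpow_one]

theorem mainTheorem2 (f : ℝ → ℝ) (hf : ContinuousOn f (Set.Icc 0 (2 * Real.pi)))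
    (hsum : Summable fun n : ℤ =>
      ‖fourierCoeffOn Real.two_pi_pos (fun t => (f t : ℂ)) n‖) :
    ∃ (F : InfFramework) (P : unitInterval → ℕ → Plane),
      F.IsLinkage P ∧ F.Pointed ∧ F.LocallyFinite ∧
        InfFramework.LimitPointTraces P (planeGraph f (Set.Icc 0 (2 * Real.pi))) := by
  have hpi := Real.pi_pos
  obtain ⟨c, hc, h⟩ := exists_hasSum_driver hf hsum
  have S := attachedSystem_position c continuous_driver norm_driver im_driver_ne_zero
    abs_re_driver_le strictMono_re_driver
  have hlim := fun t => tendsto_position hc (norm_driver t) (h t)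
  have hmem : ∀ t : unitInterval, 2 * Real.pi * (t : ℝ) ∈ Set.Icc 0 (2 * Real.pi) := fun t =>
    ⟨mul_nonneg (by positivity) t.2.1, mul_le_of_le_one_right (by positivity) t.2.2⟩
  refine ⟨S.framework, AttachedSystem.motion _, S.isLinkage, S.pointed (hlim 0), S.locallyFinite,
    fun t => toPlane ((2 * Real.pi * t : ℝ) + f (2 * Real.pi * t) * Complex.I), ?_, ?_, ?_, ?_⟩
  · have hft : Continuous fun t : unitInterval => f (2 * Real.pi * t) :=
      hf.comp_continuous (by fun_prop) hmem
    have hx : Continuous fun t : unitInterval => 2 * Real.pi * (t : ℝ) := by fun_prop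
    exact toPlane.continuous.comp ((Complex.continuous_ofReal.comp hx).add
      ((Complex.continuous_ofReal.comp hft).mul continuous_const))
  · exact fun t => (toPlane.continuous.tendsto _).comp (hlim t)
  · intro s t hst
    have hst' : (s : ℝ) < t := hst
    simp only [toPlane_apply_zero]
    simpa using mul_lt_mul_of_pos_left hst' Real.two_pi_pos
  · ext p
    constructor
    · rintro ⟨t, rfl⟩
      refine ⟨?_, ?_⟩
      · simpa [toPlane_apply_zero] using hmem t
      · simp [toPlane_apply_zero, toPlane_apply_one]
    · rintro ⟨hp0, hp1⟩
      have e : 2 * Real.pi * (p 0 / (2 * Real.pi)) = p 0 := by field_simp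
      refine ⟨⟨p 0 / (2 * Real.pi), div_nonneg hp0.1 (by positivity),
        (div_le_one (by positivity)).2 hp0.2⟩, ?_⟩
      ext i
      fin_cases i
      · simp [toPlane_apply_zero, e]
      · simp [toPlane_apply_one, e, hp1]
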